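/- A finite simple graph is called twin-free if no two distinct vertices have the same open neighbourhood. For a finite simple graph $G$, let $i_{\max}(G)$ denote the number of its maximal independent sets, i.e. independent sets of vertices that are maximal with respect to inclusion. Define $f(1)=1$, $f(2)=f(3)=2$ and, for $n \ge 4$, $$f(n)=\begin{cases} 4\cdot 3^{\frac{n}{5}-1} & \text{if } n\equiv 0 \pmod 5,\\ 5\cdot 3^{\frac{n-6}{5}} & \text{if } n\equiv 1 \pmod 5,\\ 2\cdot 3^{\frac{n-2}{5}} & \text{if } n\equiv 2 \pmod 5,\\ 8\cdot 3^{\frac{n-8}{5}} & \text{if } n\equiv 3 \pmod 5,\\ 3^{\frac{n+1}{5}} & \text{if } n\equiv 4 \pmod 5. \end{cases}$$ Then for every integer $n \ge 2$ and every twin-free forest $F$ (acyclic graph) with $n$ vertices, we have $i_{\max}(F) \ge f(n-1)$. -/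

import Mathlib

/-- A graph is twin-free if no two distinct vertices have the same open neighbourhood. -/
def SimpleGraph.TwinFree {V : Type*} (G : SimpleGraph V) : Prop :=
  ∀ u v : V, G.neighborSet u = G.neighborSet v → u = v

/-- The number of maximal (with respect to inclusion) independent sets of a graph. -/
noncomputable def SimpleGraph.imax {V : Type*} (G : SimpleGraph V) : ℕ :=
  {s : Set V | Maximal G.IsIndepSet s}.ncard

/-- The function `f` on the positive integers (the value at `0` is irrelevant).
In the last five cases `4 ≤ n`, so every subtraction and division in an exponent is exact:
there is no truncation. -/
def minTreeBound (n : ℕ) : ℕ :=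
  if n ≤ 1 then 1
  else if n ≤ 3 then 2
  else if n % 5 = 0 then 4 * 3 ^ (n / 5 - 1)
  else if n % 5 = 1 then 5 * 3 ^ ((n - 6) / 5)
  else if n % 5 = 2 then 2 * 3 ^ ((n - 2) / 5)
  else if n % 5 = 3 then 8 * 3 ^ ((n - 8) / 5)
  else 3 ^ ((n + 1) / 5)

/-! Twin-freeness allows at most one isolated vertex. Once it is discarded, no isolated vertex
remains and no two leaves share a neighbour. The core result, `LeafTwinFreeOn.minTreeBound_le`,
bounds the count below by `minTreeBound s.card` for every vertex set `s` of a forest with this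
property. The lost isolated vertex explains the argument `n - 1`.

The core is a strong induction on `s` inside a fixed graph. A component that is an edge contributes
a factor 2. Otherwise, trimming leaves twice exposes a path `u, v, w` with `u` a leaf and `v` of
degree 2, such that all but at most one neighbour `x` of `w` are leaves or further such `v`
(`exists_isPendantPath`). A maximal independent set contains exactly one of `u`, `v`, so the count
for `s` is the sum of those for `s \ {u, v}` and `s \ {u, v, w}`.

Removing branches at `w` preserves the inductive property, except that `x` may become a second leaf
at some vertex; deleting `x` then repairs the property without changing the count (`prune`,
`misCard_erase_of_isPendant`). Each case ends in a numerical inequality for `minTreeBound`. When the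
sum is too weak for such an inequality, an exact factor 3 (`misCard_eq_three_mul`) replaces it. -/

/-! ### Arithmetic of the bound. -/

/-- The residue is unchanged and the exponent grows by one. Small arguments are irregular: at `n =
3` the values are 8 and 2. -/
theorem minTreeBound_add_five {n : ℕ} (hn : 4 ≤ n) :
    minTreeBound (n + 5) = 3 * minTreeBound n := by
  have h1 : ¬ n + 5 ≤ 1 := by omega
  have h2 : ¬ n + 5 ≤ 3 := by omega
  have h3 : ¬ n ≤ 1 := by omega
  have h4 : ¬ n ≤ 3 := by omega
  simp only [minTreeBound, h1, h2, h3, h4, if_false, Nat.add_mod_right]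
  split_ifs
  · rw [show (n + 5) / 5 - 1 = n / 5 - 1 + 1 by omega, pow_succ]
    ring
  · rw [show (n + 5 - 6) / 5 = (n - 6) / 5 + 1 by omega, pow_succ]
    ring
  · rw [show (n + 5 - 2) / 5 = (n - 2) / 5 + 1 by omega, pow_succ]
    ring
  · rw [show (n + 5 - 8) / 5 = (n - 8) / 5 + 1 by omega, pow_succ]
    ring
  · rw [show (n + 5 + 1) / 5 = (n + 1) / 5 + 1 by omega, pow_succ]
    ring

/-- To prove a statement about `minTreeBound` invariant under the shift by five, it suffices to
check small arguments. -/
theorem Nat.induction_add_five {P : ℕ → Prop} (h0 : ∀ n < 9, P n)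
    (h : ∀ n, 4 ≤ n → P n → P (n + 5)) (n : ℕ) : P n := by
  induction n using Nat.strong_induction_on with
  | _ n ih =>
    by_cases hn : n < 9
    · exact h0 n hn
    · obtain ⟨m, rfl⟩ : ∃ m, n = m + 5 := ⟨n - 5, by omega⟩
      exact h m (by omega) (ih m (by omega))

theorem minTreeBound_le_succ (n : ℕ) : minTreeBound n ≤ minTreeBound (n + 1) := by
  induction n using Nat.induction_add_five with
  | h0 n hn => interval_cases n <;> simp [minTreeBound]
  | h n hn ih =>
    rw [minTreeBound_add_five hn, Nat.add_right_comm, minTreeBound_add_five (by omega)]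
    omega

theorem minTreeBound_add_two_le (n : ℕ) : minTreeBound (n + 2) ≤ 2 * minTreeBound n := by
  induction n using Nat.induction_add_five with
  | h0 n hn => interval_cases n <;> simp [minTreeBound]
  | h n hn ih =>
    rw [minTreeBound_add_five hn, Nat.add_right_comm, minTreeBound_add_five (by omega)]
    omega

/-- The excluded arguments are genuine failures (3 > 2 and 5 > 4). Here and below,
`LeafTwinFreeOn.card_ne` shows that sizes 1 and 3 do not arise. -/
theorem minTreeBound_add_three_le (n : ℕ) (h1 : n ≠ 1) (h3 : n ≠ 3) :
    minTreeBound (n + 3) ≤ 2 * minTreeBound n := by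
  induction n using Nat.induction_add_five with
  | h0 n hn => interval_cases n <;> simp_all [minTreeBound]
  | h n hn ih =>
    have := ih (by omega) (by omega)
    rw [minTreeBound_add_five hn, Nat.add_right_comm, minTreeBound_add_five (by omega)]
    omega

theorem minTreeBound_add_four_le (n : ℕ) (h1 : n ≠ 1) :
    minTreeBound (n + 4) ≤ minTreeBound (n + 2) + minTreeBound n := by
  induction n using Nat.induction_add_five with
  | h0 n hn => interval_cases n <;> simp_all [minTreeBound]
  | h n hn ih =>
    have := ih (by omega)
    rw [minTreeBound_add_five hn, Nat.add_right_comm n 5 4, minTreeBound_add_five (by omega),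
      Nat.add_right_comm n 5 2, minTreeBound_add_five (by omega)]
    omega

theorem minTreeBound_add_five_le (n : ℕ) (h0 : n ≠ 0) (h1 : n ≠ 1) (h3 : n ≠ 3) :
    minTreeBound (n + 5) ≤ 3 * minTreeBound n := by
  by_cases h : 4 ≤ n
  · exact (minTreeBound_add_five h).le
  · obtain rfl : n = 2 := by omega
    simp [minTreeBound]

theorem minTreeBound_add_six_le (n : ℕ) :
    minTreeBound (n + 6) ≤ minTreeBound (n + 4) + 2 * minTreeBound n := by
  induction n using Nat.induction_add_five with
  | h0 n hn => interval_cases n <;> simp_all [minTreeBound]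
  | h n hn ih =>
    have e0 := minTreeBound_add_five hn
    have e1 := minTreeBound_add_five (n := n + 6) (by omega)
    have e2 := minTreeBound_add_five (n := n + 4) (by omega)
    rw [Nat.add_right_comm n 5 6, Nat.add_right_comm n 5 4]
    omega

theorem minTreeBound_add_seven_le (n : ℕ) (h1 : n ≠ 1) :
    minTreeBound (n + 7) ≤ minTreeBound (n + 5) + 2 * minTreeBound n := by
  induction n using Nat.induction_add_five with
  | h0 n hn => interval_cases n <;> simp_all [minTreeBound]
  | h n hn ih =>
    have := ih (by omega)
    have e0 := minTreeBound_add_five hn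
    have e1 := minTreeBound_add_five (n := n + 7) (by omega)
    have e2 := minTreeBound_add_five (n := n + 5) (by omega)
    rw [Nat.add_right_comm n 5 7, Nat.add_right_comm n 5 5]
    omega

/-! ### Vertices of small degree in forests. -/

namespace SimpleGraph

variable {V : Type*} {G : SimpleGraph V}

/-- Every nonempty finite set of vertices of an acyclic graph contains a vertex with at most one
neighbour in that set. -/
theorem IsAcyclic.exists_subsingleton_neighbors (h : G.IsAcyclic) (t : Finset V)
    (ht : t.Nonempty) :
    ∃ v ∈ t, ∀ a ∈ t, ∀ b ∈ t, G.Adj v a → G.Adj v b → a = b := by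
  classical
  obtain ⟨r, hr⟩ := ht
  let H := G.induce (t : Set V)
  have hH : H.IsAcyclic := h.induce _
  let c := H.connectedComponentMk ⟨r, hr⟩
  have hc : c.toSimpleGraph.IsTree := hH.isTree_connectedComponent c
  have key : ∃ v : c, ∀ a b : c, c.toSimpleGraph.Adj v a → c.toSimpleGraph.Adj v b → a = b := by
    have : Finite (t : Set V) := t.finite_toSet
    have : Finite c := Subtype.finite
    have : Fintype c := Fintype.ofFinite _
    rcases subsingleton_or_nontrivial c with hs | hn
    · exact ⟨⟨⟨r, hr⟩, rfl⟩, fun a b _ _ => Subsingleton.elim _ _⟩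
    · obtain ⟨v, hv⟩ := hc.exists_vert_degree_one_of_nontrivial
      rw [degree_eq_one_iff_existsUnique_adj] at hv
      exact ⟨v, fun a b ha hb => hv.unique ha hb⟩
  obtain ⟨v, hv⟩ := key
  refine ⟨v.1.1, v.1.2, fun a ha b hb hva hvb => ?_⟩
  have mem : ∀ a (ha : a ∈ t), G.Adj v.1.1 a → H.connectedComponentMk ⟨a, ha⟩ = c := by
    intro a ha hva
    have h1 : H.Adj v.1 ⟨a, ha⟩ := hva
    have h2 : H.connectedComponentMk v.1 = c := v.2
    rw [← h2]
    exact (ConnectedComponent.connectedComponentMk_eq_of_adj h1).symm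
  have := hv ⟨⟨a, ha⟩, mem a ha hva⟩ ⟨⟨b, hb⟩, mem b hb hvb⟩ hva hvb
  exact congrArg (fun z : c => z.1.1) this

/-! ### Maximal independent sets of induced subgraphs, with the ambient graph fixed. -/

open Classical in
/-- The maximal independent sets of the subgraph induced by a finite set `s`. -/
noncomputable def misFinset (G : SimpleGraph V) (s : Finset V) : Finset (Finset V) :=
  {t ∈ s.powerset | (∀ a ∈ t, ∀ b ∈ t, ¬ G.Adj a b) ∧ ∀ a ∈ s, a ∉ t → ∃ b ∈ t, G.Adj a b}

/-- The number of maximal independent sets of the subgraph induced by a finite set. -/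
noncomputable def misCard (G : SimpleGraph V) (s : Finset V) : ℕ := (G.misFinset s).card

theorem mem_misFinset {s t : Finset V} : t ∈ G.misFinset s ↔ t ⊆ s ∧
    (∀ a ∈ t, ∀ b ∈ t, ¬ G.Adj a b) ∧ ∀ a ∈ s, a ∉ t → ∃ b ∈ t, G.Adj a b := by
  simp [misFinset]

theorem imax_eq_misCard [Fintype V] : G.imax = G.misCard Finset.univ := by
  classical
  have : {s : Set V | Maximal G.IsIndepSet s} =
      (fun t : Finset V => (t : Set V)) '' (G.misFinset Finset.univ : Set (Finset V)) := by
    ext s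
    constructor
    · intro hs
      refine ⟨s.toFinset, ?_, by simp⟩
      rw [Finset.mem_coe, mem_misFinset]
      refine ⟨Finset.subset_univ _, ?_, ?_⟩
      · intro a ha b hb hab
        simp only [Set.mem_toFinset] at ha hb
        exact hs.prop ha hb hab.ne hab
      · intro a _ ha
        by_contra! hcon
        simp only [Set.mem_toFinset] at ha hcon
        have hins : G.IsIndepSet (insert a s) := by
          intro x hx y hy hxy hadj
          rcases hx with rfl | hx <;> rcases hy with rfl | hy
          · exact hxy rfl
          · exact hcon y hy hadj
          · exact hcon x hx hadj.symm
          · exact hs.prop hx hy hxy hadj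
        exact ha (hs.le_of_ge hins (Set.subset_insert a s) (Set.mem_insert a s))
    · rintro ⟨t, ht, rfl⟩
      rw [Finset.mem_coe, mem_misFinset] at ht
      refine ⟨fun a ha b hb _ => ht.2.1 a ha b hb, ?_⟩
      intro r hr htr a har
      by_contra hat
      obtain ⟨b, hb, hab⟩ := ht.2.2 a (Finset.mem_univ a) hat
      exact hr har (htr hb) hab.ne hab
  rw [imax, this, Set.ncard_image_of_injective _ Finset.coe_injective, Set.ncard_coe_finset,
    misCard]

variable [DecidableEq V]

/-- The vertices of `s` outside the closed neighbourhood of `v`. -/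
noncomputable def awayFrom (G : SimpleGraph V) (v : V) (s : Finset V) : Finset V :=
  open Classical in {a ∈ s | a ≠ v ∧ ¬ G.Adj v a}

theorem mem_awayFrom {v a : V} {s : Finset V} :
    a ∈ G.awayFrom v s ↔ a ∈ s ∧ a ≠ v ∧ ¬ G.Adj v a := by
  simp [awayFrom]

theorem card_filter_mem_misFinset {s : Finset V} {v : V} (hv : v ∈ s) :
    {t ∈ G.misFinset s | v ∈ t}.card = G.misCard (G.awayFrom v s) := by
  rw [misCard]
  refine Finset.card_bij' (fun t _ => t.erase v) (fun t _ => insert v t) ?_ ?_ ?_ ?_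
  · intro t ht
    simp only [Finset.mem_filter, mem_misFinset] at ht
    simp only [mem_misFinset, mem_awayFrom, Finset.subset_iff, Finset.mem_erase] at ht ⊢
    obtain ⟨⟨h1, h2, h3⟩, h4⟩ := ht
    refine ⟨fun a ha => ⟨h1 ha.2, ha.1, h2 v h4 a ha.2⟩, fun a ha b hb => h2 a ha.2 b hb.2, ?_⟩
    rintro a ⟨ha, hav, hva⟩ hat
    obtain ⟨b, hb, hab⟩ := h3 a ha (fun h => hat ⟨hav, h⟩)
    refine ⟨b, ⟨?_, hb⟩, hab⟩
    rintro rfl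
    exact hva hab.symm
  · intro t ht
    simp only [Finset.mem_filter, mem_misFinset, mem_awayFrom, Finset.subset_iff,
      Finset.mem_insert] at ht ⊢
    obtain ⟨h1, h2, h3⟩ := ht
    refine ⟨⟨?_, ?_, ?_⟩, by simp⟩
    · rintro a (rfl | ha)
      exacts [hv, (h1 ha).1]
    · rintro a (rfl | ha) b (rfl | hb)
      · exact G.irrefl
      · exact (h1 hb).2.2
      · exact fun h => (h1 ha).2.2 h.symm
      · exact h2 a ha b hb
    · intro a ha hat
      push Not at hat
      by_cases hva : G.Adj v a
      · exact ⟨v, Or.inl rfl, hva.symm⟩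
      · obtain ⟨b, hb, hab⟩ := h3 a ⟨ha, hat.1, hva⟩ hat.2
        exact ⟨b, Or.inr hb, hab⟩
  · intro t ht
    exact Finset.insert_erase (Finset.mem_filter.1 ht).2
  · intro t ht
    refine Finset.erase_insert fun h => ?_
    exact (mem_awayFrom.1 ((mem_misFinset.1 ht).1 h)).2.1 rfl

/-! ### Recursions at leaves, isolated vertices and edge components. -/

/-- `u` is a vertex of `s` whose only neighbour in `s` is `v`. -/
def IsPendant (G : SimpleGraph V) (s : Finset V) (u v : V) : Prop :=
  u ∈ s ∧ v ∈ s ∧ G.Adj u v ∧ ∀ a ∈ s, G.Adj u a → a = v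

/-- By independence and maximality, a maximal independent set contains exactly one of the leaf `u`
and its neighbour `v`. The two summands count these two kinds. -/
theorem misCard_of_isPendant {s : Finset V} {u v : V} (h : G.IsPendant s u v) :
    G.misCard s = G.misCard (s \ {u, v}) + G.misCard (G.awayFrom v s) := by
  obtain ⟨hu, hv, huv, huniq⟩ := h
  have e : G.awayFrom u s = s \ {u, v} := by
    ext a
    simp only [mem_awayFrom, Finset.mem_sdiff, Finset.mem_insert, Finset.mem_singleton, not_or]
    refine ⟨fun h => ⟨h.1, h.2.1, ?_⟩, fun h => ⟨h.1, h.2.1, fun hua => h.2.2 (huniq a h.1 hua)⟩⟩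
    rintro rfl
    exact h.2.2 huv
  rw [← e, ← card_filter_mem_misFinset hu, ← card_filter_mem_misFinset hv, misCard,
    ← Finset.card_filter_add_card_filter_not (p := fun t => u ∈ t)]
  congr 2
  refine Finset.filter_congr fun t ht => ?_
  obtain ⟨h1, h2, h3⟩ := mem_misFinset.1 ht
  refine ⟨fun hut => ?_, fun hvt hut => h2 u hut v hvt huv⟩
  obtain ⟨b, hb, hub⟩ := h3 u hu hut
  exact huniq b (h1 hb) hub ▸ hb

theorem misCard_erase_of_isolated {s : Finset V} {a : V} (ha : a ∈ s)
    (h : ∀ b ∈ s, ¬ G.Adj a b) : G.misCard s = G.misCard (s.erase a) := by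
  have e : G.awayFrom a s = s.erase a := by
    ext b
    simp only [mem_awayFrom, Finset.mem_erase]
    have := h b
    tauto
  rw [← e, ← card_filter_mem_misFinset ha, misCard]
  congr 1
  refine (Finset.filter_true_of_mem fun t ht => ?_).symm
  obtain ⟨h1, h2, h3⟩ := mem_misFinset.1 ht
  by_contra hat
  obtain ⟨b, hb, hab⟩ := h3 a ha hat
  exact h b (h1 hb) hab

/-- Branching at the leaf `u` shows that a twin `x` is redundant: it is isolated once `u` and `p`
are removed, and it disappears with the neighbourhood of `p`. -/
theorem misCard_erase_of_isPendant {s : Finset V} {u x p : V} (hu : G.IsPendant s u p)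
    (hx : G.IsPendant s x p) (hux : u ≠ x) : G.misCard s = G.misCard (s.erase x) := by
  obtain ⟨h1, h2, h3, h4⟩ := hu
  obtain ⟨k1, k2, k3, k4⟩ := hx
  have hu' : G.IsPendant (s.erase x) u p :=
    ⟨Finset.mem_erase.2 ⟨hux, h1⟩, Finset.mem_erase.2 ⟨k3.ne', h2⟩, h3,
      fun a ha => h4 a (Finset.mem_of_mem_erase ha)⟩
  rw [misCard_of_isPendant ⟨h1, h2, h3, h4⟩, misCard_of_isPendant hu']
  have e1 : G.awayFrom p (s.erase x) = G.awayFrom p s := by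
    ext a
    simp only [mem_awayFrom, Finset.mem_erase]
    refine ⟨fun h => ⟨h.1.2, h.2⟩, fun h => ⟨⟨?_, h.1⟩, h.2⟩⟩
    rintro rfl
    exact h.2.2 k3.symm
  have hxs : x ∈ s \ {u, p} := by
    simp only [Finset.mem_sdiff, Finset.mem_insert, Finset.mem_singleton, not_or]
    exact ⟨k1, hux.symm, k3.ne⟩
  have e2 : (s \ {u, p}).erase x = s.erase x \ {u, p} := by
    ext a
    simp only [Finset.mem_erase, Finset.mem_sdiff]
    tauto
  rw [e1, ← e2, ← misCard_erase_of_isolated hxs]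
  intro b hb hxb
  rw [Finset.mem_sdiff] at hb
  have := k4 b hb.1 hxb
  simp [this] at hb

theorem misCard_of_edge_component {s : Finset V} {u v : V} (hu : G.IsPendant s u v)
    (hv : G.IsPendant s v u) : G.misCard s = 2 * G.misCard (s \ {u, v}) := by
  have e : G.awayFrom v s = s \ {u, v} := by
    ext a
    simp only [mem_awayFrom, Finset.mem_sdiff, Finset.mem_insert, Finset.mem_singleton, not_or]
    refine ⟨fun h => ⟨h.1, ?_, h.2.1⟩, fun h => ⟨h.1, h.2.2, fun hva => h.2.1 (hv.2.2.2 a h.1 hva)⟩⟩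
    rintro rfl
    exact h.2.2 hu.2.2.1.symm
  rw [misCard_of_isPendant hu, e, two_mul]

/-! ### The inductive property and its behaviour under deletion. -/

/-- The graph induced by `s` has no isolated vertices, and no two of its leaves share their
neighbour. For acyclic graphs this says that it is twin-free and without isolated vertices. -/
structure LeafTwinFreeOn (G : SimpleGraph V) (s : Finset V) : Prop where
  exists_adj : ∀ a ∈ s, ∃ b ∈ s, G.Adj a b
  eq_of_isPendant : ∀ a b p, G.IsPendant s a p → G.IsPendant s b p → a = b

/-- `u` is a leaf attached to `v`, the only other neighbour of `v` is `w`, and `w` is no leaf. -/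
def IsPendantPath (G : SimpleGraph V) (s : Finset V) (u v w : V) : Prop :=
  G.IsPendant s u v ∧ w ∈ s ∧ u ≠ w ∧ G.Adj v w ∧ (∀ a ∈ s, G.Adj v a → a = u ∨ a = w) ∧
    ∃ b ∈ s, G.Adj w b ∧ b ≠ v

theorem LeafTwinFreeOn.card_ne (hG : G.IsAcyclic) {s : Finset V} (hs : G.LeafTwinFreeOn s) :
    s.card ≠ 1 ∧ s.card ≠ 3 := by
  constructor
  · intro h
    obtain ⟨a, rfl⟩ := Finset.card_eq_one.1 h
    obtain ⟨b, hb, hab⟩ := hs.exists_adj a (by simp)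
    exact hab.ne (Finset.mem_singleton.1 hb).symm
  -- On three vertices, a vertex `v` of degree one and its neighbour `p` leave a third vertex that
  -- can only be attached to `p`, giving two leaves at `p`.
  · intro h
    obtain ⟨v, hv, hv1⟩ := hG.exists_subsingleton_neighbors s (Finset.card_pos.1 (by omega))
    obtain ⟨p, hp, hvp⟩ := hs.exists_adj v hv
    have h1 : (s \ {v, p}).card = 1 := by
      have := Finset.card_sdiff_add_card_eq_card (s := {v, p}) (t := s)
        (by simp [Finset.insert_subset_iff, hv, hp])
      rw [Finset.card_pair hvp.ne] at this
      omega
    obtain ⟨c, hc⟩ := Finset.card_eq_one.1 h1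
    have hc' : ∀ a, a ∈ s ∧ a ≠ v ∧ a ≠ p ↔ a = c := fun a => by
      simpa using Finset.ext_iff.1 hc a
    obtain ⟨hcs, hcv, hcp⟩ := (hc' c).2 rfl
    obtain ⟨q, hq, hcq⟩ := hs.exists_adj c hcs
    have hcnv : ¬ G.Adj c v := fun h => hcp (hv1 c hcs p hp h.symm hvp)
    have hall : ∀ a ∈ s, G.Adj c a → a = p := by
      intro a ha hca
      by_contra hap
      by_cases hav : a = v
      · exact hcnv (hav ▸ hca)
      · exact hca.ne ((hc' a).1 ⟨ha, hav, hap⟩).symm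
    obtain rfl := hall q hq hcq
    exact hcv (hs.eq_of_isPendant c v q ⟨hcs, hp, hcq, hall⟩
      ⟨hv, hp, hvp, fun a ha hva => hv1 a ha q hp hva hvp⟩)

/-- Removing vertices from a leaf-twin-free set such that all remaining vertices that lose a
neighbour, except `x`, keep a leaf, yields a leaf-twin-free set, possibly after removing `x` too. -/
theorem LeafTwinFreeOn.prune {s r : Finset V} (hs : G.LeafTwinFreeOn s) (hr : r ⊆ s) (x : V)
    (hx : x ∈ r → ∃ b ∈ r, G.Adj x b)
    (h : ∀ a ∈ r, a ≠ x → (∀ b ∈ s, G.Adj a b → b ∈ r) ∨ ∃ b ∈ r, G.IsPendant s b a) :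
    G.LeafTwinFreeOn r ∨ (G.LeafTwinFreeOn (r.erase x) ∧
      ∃ p q, G.IsPendant r x p ∧ G.IsPendant r q p ∧ q ≠ x ∧ G.IsPendant s q p) := by
  have iso : ∀ a ∈ r, ∃ b ∈ r, G.Adj a b := by
    intro a ha
    by_cases hax : a = x
    · exact hax ▸ hx (hax ▸ ha)
    · obtain h1 | ⟨b, hb, hba⟩ := h a ha hax
      · obtain ⟨b, hb, hab⟩ := hs.exists_adj a (hr ha)
        exact ⟨b, h1 b hb hab, hab⟩
      · exact ⟨b, hb, hba.2.2.1.symm⟩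
  -- A leaf `a ≠ x` of `r` that has lost a neighbour would have to keep a leaf of `s`, necessarily
  -- `p`; but `p` is also adjacent to `b`. So twin leaves of `r` other than `x` were already leaves
  -- in `s`, and any twin pair must involve `x`.
  have pend : ∀ a b p, G.IsPendant r a p → G.IsPendant r b p → a ≠ b → a ≠ x →
      G.IsPendant s a p := by
    intro a b p ha hb hab hax
    refine ⟨hr ha.1, hr ha.2.1, ha.2.2.1, ?_⟩
    obtain h1 | ⟨c, hc, hca⟩ := h a ha.1 hax
    · exact fun d hd had => ha.2.2.2 d (h1 d hd had) had
    · obtain rfl := ha.2.2.2 c hc hca.2.2.1.symm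
      exact absurd (hca.2.2.2 b (hr hb.1) hb.2.2.1.symm).symm hab
  by_cases hg : ∀ a b p, G.IsPendant r a p → G.IsPendant r b p → a = b
  · exact Or.inl ⟨iso, hg⟩
  right
  push Not at hg
  have : ∃ p q, G.IsPendant r x p ∧ G.IsPendant r q p ∧ q ≠ x ∧ G.IsPendant s q p := by
    obtain ⟨a, b, p, ha, hb, hab⟩ := hg
    by_cases hax : a = x
    · subst hax
      exact ⟨p, b, ha, hb, hab.symm, pend b a p hb ha hab.symm hab.symm⟩
    by_cases hbx : b = x
    · subst hbx
      exact ⟨p, a, hb, ha, hab, pend a b p ha hb hab hab⟩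
    · exact absurd (hs.eq_of_isPendant a b p (pend a b p ha hb hab hax)
        (pend b a p hb ha hab.symm hbx)) hab
  refine ⟨?_, this⟩
  obtain ⟨p, q, hxp, hqp, hqx, hqs⟩ := this
  constructor
  · intro a ha
    rw [Finset.mem_erase] at ha
    obtain ⟨b, hb, hab⟩ := iso a ha.2
    by_cases hbx : b = x
    · subst hbx
      obtain rfl := hxp.2.2.2 a ha.2 hab.symm
      exact ⟨q, Finset.mem_erase.2 ⟨hqx, hqp.1⟩, hqp.2.2.1.symm⟩
    · exact ⟨b, Finset.mem_erase.2 ⟨hbx, hb⟩, hab⟩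
  -- Deleting `x` can turn only `p` into a new leaf. In that case `p` and `q` form an edge
  -- component, so `p` has no twin.
  · have up : ∀ a d, G.IsPendant (r.erase x) a d → a ≠ p → G.IsPendant r a d := by
      intro a d h1 hap
      refine ⟨Finset.mem_of_mem_erase h1.1, Finset.mem_of_mem_erase h1.2.1, h1.2.2.1, ?_⟩
      intro e he hae
      by_cases hex : e = x
      · subst hex
        exact absurd (hxp.2.2.2 a (Finset.mem_of_mem_erase h1.1) hae.symm) hap
      · exact h1.2.2.2 e (Finset.mem_erase.2 ⟨hex, he⟩) hae
    have key : ∀ b d, G.IsPendant (r.erase x) p d → G.IsPendant (r.erase x) b d → p = b := by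
      intro b d h1 h2
      obtain rfl := h1.2.2.2 q (Finset.mem_erase.2 ⟨hqx, hqp.1⟩) hqp.2.2.1.symm
      exact (hqp.2.2.2 b (Finset.mem_of_mem_erase h2.1) h2.2.2.1.symm).symm
    intro a b d ha hb
    by_contra hab
    by_cases hap : a = p
    · subst hap
      exact hab (key b d ha hb)
    by_cases hbp : b = p
    · subst hbp
      exact hab (key a d hb ha).symm
    exact hab (hs.eq_of_isPendant a b d
      (pend a b d (up a d ha hap) (up b d hb hbp) hab (Finset.ne_of_mem_erase ha.1))
      (pend b a d (up b d hb hbp) (up a d ha hap) (Ne.symm hab) (Finset.ne_of_mem_erase hb.1)))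

/-! ### Finding a pendant path at the edge of the forest. -/

theorem LeafTwinFreeOn.exists_isPendantPath (hG : G.IsAcyclic) {s : Finset V}
    (hs : G.LeafTwinFreeOn s) (hne : s.Nonempty)
    (hK : ∀ u v, G.IsPendant s u v → ¬ G.IsPendant s v u) :
    ∃ u v w x, G.IsPendantPath s u v w ∧
      (∀ a ∈ s, G.Adj w a → a ≠ x → G.IsPendant s a w ∨ ∃ u', G.IsPendantPath s u' a w) ∧
      (x = w ∨ x ∈ s ∧ G.Adj w x ∧ x ≠ v ∧ ∃ b ∈ s, b ≠ w ∧ G.Adj x b) := by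
  classical
  -- `S` keeps the vertices of degree at least two, and `T` those that still have degree at least
  -- two within `S`. A vertex of `S` outside `T` with a neighbour `w` in `S` has just one leaf
  -- besides `w`, and so is the middle of a pendant path.
  let S : Finset V := {a ∈ s | ∃ b ∈ s, ∃ c ∈ s, b ≠ c ∧ G.Adj a b ∧ G.Adj a c}
  let T : Finset V := {a ∈ S | ∃ b ∈ S, ∃ c ∈ S, b ≠ c ∧ G.Adj a b ∧ G.Adj a c}
  have memS : ∀ a, a ∈ S ↔ a ∈ s ∧ ∃ b ∈ s, ∃ c ∈ s, b ≠ c ∧ G.Adj a b ∧ G.Adj a c :=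
    fun a => Finset.mem_filter
  have memT : ∀ a, a ∈ T ↔ a ∈ S ∧ ∃ b ∈ S, ∃ c ∈ S, b ≠ c ∧ G.Adj a b ∧ G.Adj a c :=
    fun a => Finset.mem_filter
  have leaf : ∀ a ∈ s, a ∉ S → ∀ p ∈ s, G.Adj a p → G.IsPendant s a p := by
    intro a ha haS p hp hap
    refine ⟨ha, hp, hap, fun b hb hab => ?_⟩
    by_contra hbp
    exact haS ((memS a).2 ⟨ha, b, hb, p, hp, hbp, hab, hap⟩)
  have path : ∀ v ∈ S, v ∉ T → ∀ w ∈ S, G.Adj v w → ∃ u, G.IsPendantPath s u v w := by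
    intro v hv hvT w hw hvw
    have huniq : ∀ a ∈ S, G.Adj v a → a = w := by
      intro a ha hva
      by_contra haw
      exact hvT ((memT v).2 ⟨hv, a, ha, w, hw, haw, hva, hvw⟩)
    obtain ⟨hvs, b, hb, c, hc, hbc, hvb, hvc⟩ := (memS v).1 hv
    obtain ⟨u, hu, huw, hvu⟩ : ∃ u ∈ s, u ≠ w ∧ G.Adj v u := by
      by_cases hbw : b = w
      · exact ⟨c, hc, fun h => hbc (hbw.trans h.symm), hvc⟩
      · exact ⟨b, hb, hbw, hvb⟩
    have hup := leaf u hu (fun h => huw (huniq u h hvu)) v hvs hvu.symm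
    obtain ⟨hws, d, hd, e, he, hde, hwd, hwe⟩ := (memS w).1 hw
    refine ⟨u, hup, hws, huw, hvw, ?_, ?_⟩
    · intro a ha hva
      by_cases haS : a ∈ S
      · exact Or.inr (huniq a haS hva)
      · exact Or.inl (hs.eq_of_isPendant a u v (leaf a ha haS v hvs hva.symm) hup)
    · by_cases hdv : d = v
      · exact ⟨e, he, hwe, fun h => hde (hdv.trans h.symm)⟩
      · exact ⟨d, hd, hwd, hdv⟩
  have hSne : S.Nonempty := by
    obtain ⟨a, ha⟩ := hne
    by_cases haS : a ∈ S
    · exact ⟨a, haS⟩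
    obtain ⟨p, hp, hap⟩ := hs.exists_adj a ha
    by_cases hpS : p ∈ S
    · exact ⟨p, hpS⟩
    · exact absurd (leaf p hp hpS a ha hap.symm) (hK a p (leaf a ha haS p hp hap))
  by_cases hT : T.Nonempty
  · obtain ⟨w, hw, hw1⟩ := hG.exists_subsingleton_neighbors T hT
    obtain ⟨hwS, b, hb, c, hc, hbc, hwb, hwc⟩ := (memT w).1 hw
    obtain ⟨v, hv, hvT, hwv⟩ : ∃ v ∈ S, v ∉ T ∧ G.Adj w v := by
      by_cases hbT : b ∈ T
      · exact ⟨c, hc, fun h => hbc (hw1 b hbT c h hwb hwc), hwc⟩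
      · exact ⟨b, hb, hbT, hwb⟩
    obtain ⟨u, hu⟩ := path v hv hvT w hwS hwv.symm
    have rest : ∀ a ∈ s, G.Adj w a → a ∉ T →
        G.IsPendant s a w ∨ ∃ u', G.IsPendantPath s u' a w := by
      intro a ha hwa haT
      by_cases haS : a ∈ S
      · exact Or.inr (path a haS haT w hwS hwa.symm)
      · exact Or.inl (leaf a ha haS w ((memS w).1 hwS).1 hwa.symm)
    by_cases hx : ∃ x ∈ T, G.Adj w x
    · obtain ⟨x, hxT, hwx⟩ := hx
      obtain ⟨hxs, d, hd, e, he, hde, hxd, hxe⟩ := (memS x).1 ((memT x).1 hxT).1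
      refine ⟨u, v, w, x, hu, fun a ha hwa hax => rest a ha hwa fun h => hax ?_, Or.inr
        ⟨hxs, hwx, ?_, ?_⟩⟩
      · exact hw1 a h x hxT hwa hwx
      · rintro rfl
        exact hvT hxT
      · by_cases hdw : d = w
        · exact ⟨e, he, fun h => hde (hdw.trans h.symm), hxe⟩
        · exact ⟨d, hd, hdw, hxd⟩
    -- Choosing `x = w` encodes that there is no exceptional neighbour, since `w` is not adjacent to
    -- itself.
    · exact ⟨u, v, w, w, hu, fun a ha hwa _ => rest a ha hwa fun h => hx ⟨a, h, hwa⟩, Or.inl rfl⟩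
  · have hTe : ∀ a, a ∉ T := fun a h => hT ⟨a, h⟩
    obtain ⟨v, hv⟩ := hSne
    obtain ⟨hvs, b, hb, c, hc, hbc, hvb, hvc⟩ := (memS v).1 hv
    -- Otherwise the two neighbours `b`, `c` of `v` would be leaves sharing `v`.
    obtain ⟨w, hw, hvw⟩ : ∃ w ∈ S, G.Adj v w := by
      by_contra! hcon
      exact hbc (hs.eq_of_isPendant b c v (leaf b hb (fun h => hcon b h hvb) v hvs hvb.symm)
        (leaf c hc (fun h => hcon c h hvc) v hvs hvc.symm))
    obtain ⟨u, hu⟩ := path v hv (hTe v) w hw hvw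
    refine ⟨u, v, w, w, hu, fun a ha hwa _ => ?_, Or.inl rfl⟩
    by_cases haS : a ∈ S
    · exact Or.inr (path a haS (hTe a) w hw hwa.symm)
    · exact Or.inl (leaf a ha haS w ((memS w).1 hw).1 hwa.symm)

/-! ### Counts and deletions around a pendant path. -/

/-- The component is the path `u, v, w, l`, whose maximal independent sets are `{u, w}`, `{u, l}`
and `{v, l}`. -/
theorem misCard_of_path_component {s : Finset V} {u v w l : V} (hu : G.IsPendant s u v)
    (hl : G.IsPendant s l w) (hvw : G.Adj v w) (hv : ∀ a ∈ s, G.Adj v a → a = u ∨ a = w)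
    (hw : ∀ a ∈ s, G.Adj w a → a = l ∨ a = v) (huw : u ≠ w) (hlv : l ≠ v) :
    G.misCard s = 3 * G.misCard (s \ {u, v, w, l}) := by
  have hul : u ≠ l := by
    rintro rfl
    exact hvw.ne (hl.2.2.2 v hu.2.1 hu.2.2.1)
  have h1 : G.misCard (s \ {u, v}) = 2 * G.misCard (s \ {u, v, w, l}) := by
    have e : s \ {u, v, w, l} = (s \ {u, v}) \ {w, l} := by grind
    rw [e]
    unfold IsPendant at hu hl
    refine misCard_of_edge_component ?_ ?_ <;> unfold IsPendant <;>
      grind [SimpleGraph.adj_comm, SimpleGraph.irrefl]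
  have e2 : G.awayFrom v s = s \ {u, v, w} := by
    ext a
    unfold IsPendant at hu hl
    grind [mem_awayFrom, SimpleGraph.adj_comm, SimpleGraph.irrefl]
  have e3 : s \ {u, v, w, l} = (s \ {u, v, w}).erase l := by grind
  have h2 : G.misCard (s \ {u, v, w}) = G.misCard (s \ {u, v, w, l}) := by
    rw [e3]
    unfold IsPendant at hu hl
    refine misCard_erase_of_isolated ?_ ?_ <;>
      grind [SimpleGraph.adj_comm, SimpleGraph.irrefl]
  rw [misCard_of_isPendant hu, e2, h1, h2]
  ring

theorem LeafTwinFreeOn.prune_of_notMem {s r : Finset V} (hs : G.LeafTwinFreeOn s) (hr : r ⊆ s)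
    {x : V} (hx : x ∉ r)
    (h : ∀ a ∈ r, (∀ b ∈ s, G.Adj a b → b ∈ r) ∨ ∃ b ∈ r, G.IsPendant s b a) :
    G.LeafTwinFreeOn r := by
  rcases hs.prune hr x (fun h => absurd h hx) (fun a ha _ => h a ha) with h | h
  · exact h
  · exact absurd h.2.choose_spec.choose_spec.1.1 hx

/-- For `w ∈ R`, `R` is made of `w` and whole branches at `w`, so only neighbours of `w` lose an
edge. Those other than `x` that remain are middles of pendant paths and keep their own leaf, so
`prune` applies with `x` as the sole exception. -/
theorem LeafTwinFreeOn.prune_branch {s R : Finset V} (hs : G.LeafTwinFreeOn s) {w x : V}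
    (hclosed : ∀ a ∈ R, a ≠ w → ∀ b ∈ s, G.Adj a b → b ∈ R)
    (hleaf : ∀ a, G.IsPendant s a w → a ∈ R)
    (hw : ∀ a ∈ s, G.Adj w a → a ≠ x → G.IsPendant s a w ∨ ∃ u', G.IsPendantPath s u' a w)
    (hx : x ∈ s → x ∉ R → ∃ b ∈ s, b ≠ w ∧ G.Adj x b) :
    G.LeafTwinFreeOn (s \ R) ∨ (G.LeafTwinFreeOn ((s \ R).erase x) ∧
      ∃ p q, G.IsPendant (s \ R) x p ∧ G.IsPendant (s \ R) q p ∧ q ≠ x ∧ G.IsPendant s q p) := by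
  refine hs.prune Finset.sdiff_subset x ?_ ?_
  · intro h
    rw [Finset.mem_sdiff] at h
    obtain ⟨b, hb, hbw, hxb⟩ := hx h.1 h.2
    exact ⟨b, Finset.mem_sdiff.2 ⟨hb, fun hbR => h.2 (hclosed b hbR hbw x h.1 hxb.symm)⟩, hxb⟩
  · intro a ha hax
    rw [Finset.mem_sdiff] at ha
    by_cases haw : G.Adj w a
    · rcases hw a ha.1 haw hax with h | ⟨u', h⟩
      · exact absurd (hleaf a h) ha.2
      · exact Or.inr ⟨u', Finset.mem_sdiff.2 ⟨h.1.1, fun hu' =>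
          ha.2 (hclosed u' hu' h.2.2.1 a ha.1 h.1.2.2.1)⟩, h.1⟩
    · refine Or.inl fun b hb hab => Finset.mem_sdiff.2 ⟨hb, fun hbR => ?_⟩
      refine ha.2 (hclosed b hbR ?_ a ha.1 hab.symm)
      rintro rfl
      exact haw hab.symm

theorem IsPendantPath.misCard_eq {s : Finset V} {u v w : V} (h : G.IsPendantPath s u v w) :
    G.misCard s = G.misCard (s \ {u, v}) + G.misCard (s \ {u, v, w}) := by
  have e : G.awayFrom v s = s \ {u, v, w} := by
    ext a
    unfold IsPendantPath IsPendant at h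
    grind [mem_awayFrom, SimpleGraph.adj_comm, SimpleGraph.irrefl]
  rw [misCard_of_isPendant h.1, e]

omit [DecidableEq V] in
theorem IsPendantPath.ne_of_isPendant {s : Finset V} {u v w l : V} (h : G.IsPendantPath s u v w)
    (hl : G.IsPendant s l w) : l ≠ u ∧ l ≠ v ∧ l ≠ w := by
  refine ⟨?_, ?_, hl.2.2.1.ne⟩
  · rintro rfl
    exact h.2.2.2.1.ne (hl.2.2.2 v h.1.2.1 h.1.2.2.1)
  · rintro rfl
    exact h.2.2.1 (hl.2.2.2 u h.1.1 h.1.2.2.1.symm)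

/-- Here `x` has degree two, joining `w` to `p`, which carries a leaf `q`. Branching at `q` rather
than at `u` makes the path `u, v, w, l` split off in both summands, and the common factor 3 comes
out. -/
theorem misCard_eq_three_mul {s : Finset V} {u v w x l p q : V}
    (hp : G.IsPendantPath s u v w) (hl : G.IsPendant s l w) (hwx : G.Adj w x)
    (hw : ∀ a ∈ s, G.Adj w a → a = l ∨ a = v ∨ a = x)
    (hxp : G.IsPendant (s \ {u, v, w, l}) x p) (hqp : G.IsPendant (s \ {u, v, w, l}) q p)
    (hqx : q ≠ x) (hq : G.IsPendant s q p) :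
    G.misCard s = 3 * G.misCard ((s \ {u, v, w, l}).erase x) := by
  have hxN : ∀ a ∈ s, G.Adj x a → a = p ∨ a = w := by
    intro a ha hxa
    unfold IsPendantPath IsPendant at hp
    unfold IsPendant at hl hxp
    simp only [Finset.mem_sdiff, Finset.mem_insert, Finset.mem_singleton, not_or] at hxp
    clear hqp hq hw
    by_cases h1 : a = u
    · grind [SimpleGraph.adj_comm]
    by_cases h2 : a = v
    · grind [SimpleGraph.adj_comm]
    by_cases h3 : a = l
    · grind [SimpleGraph.adj_comm]
    by_cases h4 : a = w
    · exact Or.inr h4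
    · exact Or.inl (hxp.2.2.2 a ⟨ha, h1, h2, h4, h3⟩ hxa)
  obtain ⟨hlu, hlv, hlw⟩ := hp.ne_of_isPendant hl
  obtain ⟨⟨hu1, hv1, huv, huN⟩, hw1, huw, hvw, hvN, -⟩ := hp
  have hqp' := hqp.1
  have hx1 := hxp.1
  have hp1 := hxp.2.1
  have hxpA := hxp.2.2.1
  simp only [Finset.mem_sdiff, Finset.mem_insert, Finset.mem_singleton, not_or] at hqp' hx1 hp1
  obtain ⟨hqs, hqu, hqv, hqw, hql⟩ := hqp'
  obtain ⟨hxs, hxu, hxv, hxw, hxl⟩ := hx1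
  obtain ⟨hps, hpu, hpv, hpw, hpl⟩ := hp1
  have hpx : p ≠ x := hxpA.ne'
  have mem : ∀ a, a ∈ s → a ≠ q → a ≠ p → a ∈ s \ {q, p} := by
    intro a h1 h2 h3
    simp [h1, h2, h3]
  have mem' : ∀ a, a ∈ s → a ≠ q → a ≠ p → a ≠ x → a ∈ (s \ {q, p}).erase x := by
    intro a h1 h2 h3 h4
    simp [h1, h2, h3, h4]
  have sub' : (s \ {q, p}).erase x ⊆ s := (Finset.erase_subset _ _).trans Finset.sdiff_subset
  -- Without `p`, the vertex `x` is a leaf at `w`, twin to `l`.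
  have h1 : G.misCard (s \ {q, p}) = G.misCard ((s \ {q, p}).erase x) := by
    refine misCard_erase_of_isPendant (u := l) (p := w)
      ⟨mem l hl.1 (Ne.symm hql) (Ne.symm hpl), mem w hw1 (Ne.symm hqw) (Ne.symm hpw), hl.2.2.1,
        fun a ha => hl.2.2.2 a (Finset.mem_sdiff.1 ha).1⟩
      ⟨mem x hxs (Ne.symm hqx) (Ne.symm hpx), mem w hw1 (Ne.symm hqw) (Ne.symm hpw), hwx.symm,
        fun a ha hxa => ?_⟩ (Ne.symm hxl)
    rw [Finset.mem_sdiff] at ha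
    refine (hxN a ha.1 hxa).resolve_left ?_
    rintro rfl
    simp at ha
  have h2 : G.misCard ((s \ {q, p}).erase x) =
      3 * G.misCard (((s \ {q, p}).erase x) \ {u, v, w, l}) := by
    have hw2 := mem' w hw1 (Ne.symm hqw) (Ne.symm hpw) (Ne.symm hxw)
    refine misCard_of_path_component
      ⟨mem' u hu1 (Ne.symm hqu) (Ne.symm hpu) (Ne.symm hxu),
        mem' v hv1 (Ne.symm hqv) (Ne.symm hpv) (Ne.symm hxv), huv, fun a ha => huN a (sub' ha)⟩
      ⟨mem' l hl.1 (Ne.symm hql) (Ne.symm hpl) (Ne.symm hxl), hw2, hl.2.2.1,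
        fun a ha => hl.2.2.2 a (sub' ha)⟩ hvw (fun a ha => hvN a (sub' ha)) ?_ huw hlv
    intro a ha hwa
    rcases hw a (sub' ha) hwa with h | h | h
    · exact Or.inl h
    · exact Or.inr h
    · exact absurd h (Finset.ne_of_mem_erase ha)
  have sub'' : ∀ a ∈ G.awayFrom p s, a ∈ s := fun a ha => (mem_awayFrom.1 ha).1
  -- In the other branch `x` is removed as a neighbour of `p`, which again isolates the path.
  have h3 : G.misCard (G.awayFrom p s) = 3 * G.misCard (G.awayFrom p s \ {u, v, w, l}) := by
    refine misCard_of_path_component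
      ⟨mem_awayFrom.2 ⟨hu1, Ne.symm hpu, fun h => hpv (huN p hps h.symm)⟩,
        mem_awayFrom.2 ⟨hv1, Ne.symm hpv, fun h => (hvN p hps h.symm).elim hpu hpw⟩, huv,
        fun a ha => huN a (sub'' a ha)⟩
      ⟨mem_awayFrom.2 ⟨hl.1, Ne.symm hpl, fun h => hpw (hl.2.2.2 p hps h.symm)⟩,
        mem_awayFrom.2 ⟨hw1, Ne.symm hpw, fun h => ?_⟩, hl.2.2.1,
        fun a ha => hl.2.2.2 a (sub'' a ha)⟩ hvw (fun a ha => hvN a (sub'' a ha)) ?_ huw hlv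
    · rcases hw p hps h.symm with h | h | h
      exacts [hpl h, hpv h, hpx h]
    · intro a ha hwa
      rcases hw a (sub'' a ha) hwa with h | h | h
      · exact Or.inl h
      · exact Or.inr h
      · rw [h] at ha
        exact absurd hxpA.symm (mem_awayFrom.1 ha).2.2
  have h4 : G.IsPendant ((s \ {u, v, w, l}).erase x) q p :=
    ⟨Finset.mem_erase.2 ⟨hqx, hqp.1⟩, Finset.mem_erase.2 ⟨hpx, hqp.2.1⟩, hqp.2.2.1,
      fun a ha => hqp.2.2.2 a (Finset.mem_of_mem_erase ha)⟩
  have e1 : G.awayFrom p s \ {u, v, w, l} = G.awayFrom p ((s \ {u, v, w, l}).erase x) := by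
    ext a
    simp only [mem_awayFrom, Finset.mem_sdiff, Finset.mem_erase]
    refine ⟨fun h => ⟨⟨?_, h.1.1, h.2⟩, h.1.2⟩, fun h => ⟨⟨h.1.2.1, h.2⟩, h.1.2.2⟩⟩
    rintro rfl
    exact h.1.2.2 hxpA.symm
  have e2 : ((s \ {q, p}).erase x) \ {u, v, w, l} = (s \ {u, v, w, l}).erase x \ {q, p} := by
    ext a
    simp only [Finset.mem_sdiff, Finset.mem_erase]
    tauto
  rw [misCard_of_isPendant hq, h1, h2, h3, misCard_of_isPendant h4, e1, e2]
  ring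

omit [DecidableEq V] in
theorem one_le_misCard_empty : 1 ≤ G.misCard ∅ := by
  rw [misCard, Nat.one_le_iff_ne_zero]
  exact Finset.card_ne_zero_of_mem (mem_misFinset.2 ⟨Finset.Subset.refl ∅, by simp, by simp⟩)

theorem ssubset_sdiff_of_mem {s R : Finset V} {a : V} (has : a ∈ s) (haR : a ∈ R) : s \ R ⊂ s :=
  (Finset.ssubset_iff_of_subset Finset.sdiff_subset).2
    ⟨a, has, fun h => (Finset.mem_sdiff.1 h).2 haR⟩

theorem IsPendantPath.card_sdiff_pair {s : Finset V} {u v w : V} (h : G.IsPendantPath s u v w) :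
    (s \ {u, v}).card + 2 = s.card := by
  rw [← Finset.card_pair h.1.2.2.1.ne, Finset.card_sdiff_add_card_eq_card]
  simp [Finset.insert_subset_iff, h.1.1, h.1.2.1]

theorem IsPendantPath.card_sdiff_triple {s : Finset V} {u v w : V}
    (h : G.IsPendantPath s u v w) : (s \ {u, v, w}).card + 3 = s.card := by
  rw [← Finset.card_eq_three.2 ⟨u, v, w, h.1.2.2.1.ne, h.2.2.1, h.2.2.2.1.ne, rfl⟩,
    Finset.card_sdiff_add_card_eq_card]
  simp [Finset.insert_subset_iff, h.1.1, h.1.2.1, h.2.1]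

theorem IsPendantPath.sdiff_erase_eq {s : Finset V} {u v w l : V} :
    (s \ {u, v, w}).erase l = s \ {u, v, w, l} := by
  grind

theorem IsPendantPath.card_sdiff_quadruple {s : Finset V} {u v w l : V}
    (h : G.IsPendantPath s u v w) (hl : G.IsPendant s l w) :
    (s \ {u, v, w, l}).card + 4 = s.card := by
  obtain ⟨h1, h2, h3⟩ := h.ne_of_isPendant hl
  have := Finset.card_erase_add_one (s := s \ {u, v, w}) (a := l) (by simp [hl.1, h1, h2, h3])
  rw [sdiff_erase_eq] at this
  have := h.card_sdiff_triple
  omega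

theorem IsPendantPath.misCard_sdiff_triple {s : Finset V} {u v w l : V}
    (h : G.IsPendantPath s u v w) (hl : G.IsPendant s l w) :
    G.misCard (s \ {u, v, w}) = G.misCard (s \ {u, v, w, l}) := by
  obtain ⟨h1, h2, h3⟩ := h.ne_of_isPendant hl
  rw [← sdiff_erase_eq]
  refine misCard_erase_of_isolated (by simp [hl.1, h1, h2, h3]) fun b hb hlb => ?_
  rw [Finset.mem_sdiff] at hb
  simp [hl.2.2.2 b hb.1 hlb] at hb

theorem LeafTwinFreeOn.sdiff_pair {s : Finset V} (hs : G.LeafTwinFreeOn s) {u v w l : V}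
    (h : G.IsPendantPath s u v w) (hl : G.IsPendant s l w) : G.LeafTwinFreeOn (s \ {u, v}) := by
  obtain ⟨h1, h2, h3⟩ := h.ne_of_isPendant hl
  refine hs.prune_of_notMem Finset.sdiff_subset (x := u) (by simp) fun a ha => ?_
  by_cases haw : a = w
  · exact Or.inr ⟨l, by simp [hl.1, h1, h2], haw ▸ hl⟩
  · left
    unfold IsPendantPath IsPendant at h
    clear hs hl
    grind [SimpleGraph.adj_comm]

/-- Only `w` loses a neighbour. If this makes it a twin leaf, it can be dropped at no cost. -/
theorem LeafTwinFreeOn.sdiff_pair_or {s : Finset V} (hs : G.LeafTwinFreeOn s) {u v w : V}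
    (h : G.IsPendantPath s u v w) : G.LeafTwinFreeOn (s \ {u, v}) ∨
      (G.LeafTwinFreeOn (s \ {u, v, w}) ∧ G.misCard (s \ {u, v}) = G.misCard (s \ {u, v, w})) := by
  have e : (s \ {u, v}).erase w = s \ {u, v, w} := by grind
  have hprune := hs.prune (r := s \ {u, v}) Finset.sdiff_subset w
  unfold IsPendantPath IsPendant at h
  rcases hprune (by clear hs hprune; grind [SimpleGraph.adj_comm])
    (fun a ha haw => Or.inl (by clear hs hprune; grind [SimpleGraph.adj_comm])) with
    hr | ⟨hr, p, q, hwp, hqp, hqw, -⟩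
  · exact Or.inl hr
  · rw [← e]
    exact Or.inr ⟨hr, misCard_erase_of_isPendant hqp hwp hqw⟩

/-! ### The induction. -/

theorem LeafTwinFreeOn.minTreeBound_le_of_no_leaf (hG : G.IsAcyclic) {s : Finset V}
    (hs : G.LeafTwinFreeOn s)
    (ih : ∀ t ⊂ s, G.LeafTwinFreeOn t → minTreeBound t.card ≤ G.misCard t) {u v w x : V}
    (hp : G.IsPendantPath s u v w)
    (hw : ∀ a ∈ s, G.Adj w a → a ≠ x → G.IsPendant s a w ∨ ∃ u', G.IsPendantPath s u' a w)
    (hx : x ∈ s → x ∉ ({u, v, w} : Finset V) → ∃ b ∈ s, b ≠ w ∧ G.Adj x b)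
    (hl : ∀ l, ¬ G.IsPendant s l w) : minTreeBound s.card ≤ G.misCard s := by
  have i1 : s \ {u, v} ⊂ s := ssubset_sdiff_of_mem hp.1.1 (by simp)
  have i2 : s \ {u, v, w} ⊂ s := ssubset_sdiff_of_mem hp.1.1 (by simp)
  have c1 := hp.card_sdiff_pair
  have c2 := hp.card_sdiff_triple
  rw [hp.misCard_eq]
  rcases hs.sdiff_pair_or hp with hr1 | ⟨hr1, e⟩
  · have h1 := ih _ i1 hr1
    have n1 := hr1.card_ne hG
    have key : ∀ m, (s \ {u, v, w}).card = m + 1 →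
        minTreeBound s.card ≤ minTreeBound (s \ {u, v}).card + minTreeBound m := by
      intro m hm
      rw [show (s \ {u, v}).card = m + 2 by omega, show s.card = m + 4 by omega]
      exact minTreeBound_add_four_le m (by omega)
    have hclosed : ∀ a ∈ ({u, v, w} : Finset V), a ≠ w → ∀ b ∈ s, G.Adj a b →
        b ∈ ({u, v, w} : Finset V) := by
      unfold IsPendantPath IsPendant at hp
      clear hs ih hw hx hl i1 i2 c1 c2 h1 n1 key
      grind
    rcases hs.prune_branch hclosed (fun a ha => absurd ha (hl a)) hw hx with
      hr2 | ⟨hr2, p, q, hxp, hqp, hqx, -⟩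
    · have h2 := ih _ i2 hr2
      -- The set is nonempty because `s \ {u, v}`, larger by one, cannot have size 1.
      obtain ⟨m, hm⟩ : ∃ m, (s \ {u, v, w}).card = m + 1 :=
        ⟨(s \ {u, v, w}).card - 1, by omega⟩
      have h3 := key m hm
      have h4 := minTreeBound_le_succ m
      rw [← hm] at h4
      omega
    · have h2 := ih _ ((Finset.erase_subset _ _).trans_ssubset i2) hr2
      rw [← misCard_erase_of_isPendant hqp hxp hqx] at h2
      have h3 := key _ (Finset.card_erase_add_one hxp.1).symm
      omega
  · have h2 := ih _ i2 hr1
    have n1 := hr1.card_ne hG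
    have h3 := minTreeBound_add_three_le _ n1.1 n1.2
    rw [e, ← c2]
    omega

theorem IsPendantPath.closed_quadruple {s : Finset V} {u v w l : V}
    (hp : G.IsPendantPath s u v w) (hl : G.IsPendant s l w) :
    ∀ a ∈ ({u, v, w, l} : Finset V), a ≠ w → ∀ b ∈ s, G.Adj a b →
      b ∈ ({u, v, w, l} : Finset V) := by
  unfold IsPendantPath IsPendant at hp
  unfold IsPendant at hl
  grind

theorem IsPendantPath.closed_union {s R : Finset V} {u v w : V} (hp : G.IsPendantPath s u v w)
    (hw : w ∈ R) (hR : ∀ a ∈ R, a ≠ w → ∀ b ∈ s, G.Adj a b → b ∈ R) :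
    ∀ a ∈ insert u (insert v R), a ≠ w → ∀ b ∈ s, G.Adj a b → b ∈ insert u (insert v R) := by
  unfold IsPendantPath IsPendant at hp
  simp only [Finset.mem_insert]
  rintro a (rfl | rfl | ha) haw b hb hab
  · exact Or.inr (Or.inl (hp.1.2.2.2 b hb hab))
  · rcases hp.2.2.2.2.1 b hb hab with rfl | rfl
    · exact Or.inl rfl
    · exact Or.inr (Or.inr hw)
  · exact Or.inr (Or.inr (hR a ha haw b hb hab))

omit [DecidableEq V] in
theorem IsPendantPath.notMem_of_closed {s R : Finset V} {u v w : V}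
    (hp : G.IsPendantPath s u v w) (hv : v ∉ R)
    (hR : ∀ a ∈ R, a ≠ w → ∀ b ∈ s, G.Adj a b → b ∈ R) : u ∉ R :=
  fun hu => hv (hR u hu hp.2.2.1 v hp.1.2.1 hp.1.2.2.1)

/-- With `w` gone, `u` and `v` form an edge component. -/
theorem IsPendantPath.misCard_sdiff {s R : Finset V} {u v w : V}
    (hp : G.IsPendantPath s u v w) (hw : w ∈ R) (hu : u ∉ R) (hv : v ∉ R) :
    G.misCard (s \ R) = 2 * G.misCard (s \ insert u (insert v R)) := by
  have e : s \ insert u (insert v R) = (s \ R) \ {u, v} := by grind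
  rw [e]
  refine misCard_of_edge_component ⟨?_, ?_, hp.1.2.2.1, ?_⟩ ⟨?_, ?_, hp.1.2.2.1.symm, ?_⟩
  · exact Finset.mem_sdiff.2 ⟨hp.1.1, hu⟩
  · exact Finset.mem_sdiff.2 ⟨hp.1.2.1, hv⟩
  · exact fun a ha => hp.1.2.2.2 a (Finset.mem_sdiff.1 ha).1
  · exact Finset.mem_sdiff.2 ⟨hp.1.2.1, hv⟩
  · exact Finset.mem_sdiff.2 ⟨hp.1.1, hu⟩
  · intro a ha hva
    rw [Finset.mem_sdiff] at ha
    rcases hp.2.2.2.2.1 a ha.1 hva with h | rfl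
    · exact h
    · exact absurd hw ha.2

theorem LeafTwinFreeOn.minTreeBound_le_of_leaf (hG : G.IsAcyclic) {s : Finset V}
    (hs : G.LeafTwinFreeOn s)
    (ih : ∀ t ⊂ s, G.LeafTwinFreeOn t → minTreeBound t.card ≤ G.misCard t) {u v w x l : V}
    (hp : G.IsPendantPath s u v w)
    (hw : ∀ a ∈ s, G.Adj w a → a ≠ x → G.IsPendant s a w ∨ ∃ u', G.IsPendantPath s u' a w)
    (hx : x = w ∨ x ∈ s ∧ G.Adj w x ∧ x ≠ v ∧ ∃ b ∈ s, b ≠ w ∧ G.Adj x b)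
    (hl : G.IsPendant s l w) : minTreeBound s.card ≤ G.misCard s := by
  obtain ⟨hlu, hlv, hlw⟩ := hp.ne_of_isPendant hl
  have hr1 := hs.sdiff_pair hp hl
  have h1 := ih _ (ssubset_sdiff_of_mem hp.1.1 (by simp)) hr1
  have n1 := hr1.card_ne hG
  have i2 : s \ {u, v, w, l} ⊂ s := ssubset_sdiff_of_mem hp.1.1 (by simp)
  have c1 := hp.card_sdiff_pair
  have c2 := hp.card_sdiff_quadruple hl
  have hleaf : ∀ R : Finset V, l ∈ R → ∀ a, G.IsPendant s a w → a ∈ R := by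
    intro R hR a ha
    rwa [hs.eq_of_isPendant a l w ha hl]
  have hx' : ∀ R : Finset V, w ∈ R → x ∈ s → x ∉ R → ∃ b ∈ s, b ≠ w ∧ G.Adj x b := by
    rintro R hR - hxR
    rcases hx with rfl | hx
    · exact absurd hR hxR
    · exact hx.2.2.2
  have hclosed := hp.closed_quadruple hl
  rw [hp.misCard_eq, hp.misCard_sdiff_triple hl]
  rcases hs.prune_branch hclosed (hleaf _ (by simp)) hw (hx' _ (by simp)) with
    hr2 | ⟨hr2, p, q, hxp, hqp, hqx, hq⟩
  · have h2 := ih _ i2 hr2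
    have h3 := minTreeBound_add_four_le _ (hr2.card_ne hG).1
    rw [show (s \ {u, v}).card = (s \ {u, v, w, l}).card + 2 by omega] at h1
    rw [← c2]
    omega
  have b1 := Finset.card_erase_add_one hxp.1
  have b2 := misCard_erase_of_isPendant hqp hxp hqx
  have b3 := ih _ ((Finset.erase_subset _ _).trans_ssubset i2) hr2
  -- Now `x` must be deleted too, leaving `m = s.card - 5` vertices. The available sum of the bounds
  -- at `m + 3` and `m` can fall short: for `m = 6` it is 9 + 5 < 15. Another pendant path at `w`
  -- supplies a factor 2 in the second summand; without one, `w` has only the neighbours `l`, `v`,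
  -- `x`, and the factor 3 applies.
  by_cases hk : ∃ a u', G.IsPendantPath s u' a w ∧ a ≠ v ∧ a ≠ x
  · obtain ⟨a, u', ha, hav, hax⟩ := hk
    have haR : a ∉ ({u, v, w, l} : Finset V) := by
      have h1 : a ≠ u := by
        rintro rfl
        exact hp.2.2.2.1.ne (hp.1.2.2.2 w hp.2.1 ha.2.2.2.1).symm
      simp [h1, hav, ha.2.2.2.1.ne, (ha.ne_of_isPendant hl).2.1.symm]
    have huR := ha.notMem_of_closed haR hclosed
    have hclosed' := ha.closed_union (by simp) hclosed
    have k2 := ha.misCard_sdiff (s := s) (R := {u, v, w, l}) (by simp) huR haR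
    have i3 : s \ insert u' (insert a {u, v, w, l}) ⊂ s :=
      ssubset_sdiff_of_mem hp.1.1 (by simp)
    have c3 : (s \ insert u' (insert a {u, v, w, l})).card + 2 = (s \ {u, v, w, l}).card := by
      have e : s \ insert u' (insert a {u, v, w, l}) = (s \ {u, v, w, l}) \ {u', a} := by grind
      rw [e, ← Finset.card_pair ha.1.2.2.1.ne, Finset.card_sdiff_add_card_eq_card]
      simp only [Finset.insert_subset_iff, Finset.singleton_subset_iff, Finset.mem_sdiff]
      exact ⟨⟨ha.1.1, huR⟩, ha.1.2.1, haR⟩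
    rw [k2]
    rcases hs.prune_branch hclosed' (hleaf _ (by simp)) hw (hx' _ (by simp)) with
      hr3 | ⟨hr3, p', q', hxp', hqp', hqx', -⟩
    · have h2 := ih _ i3 hr3
      have h3 := minTreeBound_add_six_le (s \ insert u' (insert a {u, v, w, l})).card
      rw [show s.card = (s \ insert u' (insert a {u, v, w, l})).card + 6 by omega]
      rw [show (s \ {u, v}).card = (s \ insert u' (insert a {u, v, w, l})).card + 4 by omega] at h1
      omega
    · have f1 := Finset.card_erase_add_one hxp'.1
      have f2 := misCard_erase_of_isPendant hqp' hxp' hqx'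
      have f3 := ih _ ((Finset.erase_subset _ _).trans_ssubset i3) hr3
      have h3 := minTreeBound_add_seven_le _ (hr3.card_ne hG).1
      rw [show (s \ {u, v}).card =
        ((s \ insert u' (insert a {u, v, w, l})).erase x).card + 5 by omega] at h1
      rw [show s.card = ((s \ insert u' (insert a {u, v, w, l})).erase x).card + 7 by omega]
      omega
  · have hwx : G.Adj w x := by
      rcases hx with rfl | hx
      · exact absurd hxp.1 (by simp)
      · exact hx.2.1
    have hw' : ∀ a ∈ s, G.Adj w a → a = l ∨ a = v ∨ a = x := by
      intro a ha hwa
      by_cases hax : a = x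
      · exact Or.inr (Or.inr hax)
      rcases hw a ha hwa hax with h | ⟨u', h⟩
      · exact Or.inl (hs.eq_of_isPendant a l w h hl)
      · by_contra hcon
        exact hk ⟨a, u', h, fun hav => hcon (Or.inr (Or.inl hav)), hax⟩
    have k0 : ((s \ {u, v, w, l}).erase x).card ≠ 0 :=
      Finset.card_ne_zero_of_mem (Finset.mem_erase.2 ⟨hqx, hqp.1⟩)
    have n2 := hr2.card_ne hG
    have h3 := minTreeBound_add_five_le _ k0 n2.1 n2.2
    rw [← hp.misCard_sdiff_triple hl, ← hp.misCard_eq,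
      misCard_eq_three_mul hp hl hwx hw' hxp hqp hqx hq,
      show s.card = ((s \ {u, v, w, l}).erase x).card + 5 by omega]
    omega

theorem LeafTwinFreeOn.minTreeBound_le (hG : G.IsAcyclic) (s : Finset V)
    (hs : G.LeafTwinFreeOn s) : minTreeBound s.card ≤ G.misCard s := by
  induction s using Finset.strongInduction with
  | H s ih =>
  rcases s.eq_empty_or_nonempty with rfl | hne
  -- The value of `minTreeBound` at 0 matters here: it is 1, for the empty independent set.
  · simpa [minTreeBound] using one_le_misCard_empty
  by_cases hK : ∃ u v, G.IsPendant s u v ∧ G.IsPendant s v u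
  · obtain ⟨u, v, hu, hv⟩ := hK
    have hr : G.LeafTwinFreeOn (s \ {u, v}) := by
      refine hs.prune_of_notMem Finset.sdiff_subset (x := u) (by simp) fun a ha => Or.inl ?_
      unfold IsPendant at hu hv
      clear hs ih
      grind [SimpleGraph.adj_comm]
    have h1 := ih _ (ssubset_sdiff_of_mem hu.1 (by simp)) hr
    have h2 := Finset.card_sdiff_add_card_eq_card (s := {u, v}) (t := s)
      (by simp [Finset.insert_subset_iff, hu.1, hv.1])
    rw [Finset.card_pair hu.2.2.1.ne] at h2
    have h3 := minTreeBound_add_two_le (s \ {u, v}).card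
    rw [misCard_of_edge_component hu hv, ← h2]
    omega
  obtain ⟨u, v, w, x, hp, hw, hx⟩ := hs.exists_isPendantPath hG hne
    (fun u v h1 h2 => hK ⟨u, v, h1, h2⟩)
  by_cases hl : ∃ l, G.IsPendant s l w
  · obtain ⟨l, hl⟩ := hl
    exact hs.minTreeBound_le_of_leaf hG ih hp hw hx hl
  · refine hs.minTreeBound_le_of_no_leaf hG ih hp hw ?_ (fun l h => hl ⟨l, h⟩)
    rintro - hxR
    rcases hx with rfl | hx
    · simp at hxR
    · exact hx.2.2.2

end SimpleGraph

/-! ### From twin-free forests to the inductive property. -/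

theorem mainTheorem7 {V : Type*} [Fintype V] (F : SimpleGraph V) (n : ℕ) (hn : 2 ≤ n)
    (hcard : Fintype.card V = n) (hforest : F.IsAcyclic) (htwin : F.TwinFree) :
    minTreeBound (n - 1) ≤ F.imax := by
  classical
  rw [SimpleGraph.imax_eq_misCard]
  have pend : ∀ s : Finset V, (∀ a p, F.IsPendant s a p → ∀ c, F.Adj a c → c ∈ s) →
      ∀ a b p, F.IsPendant s a p → F.IsPendant s b p → a = b := by
    intro s hs a b p ha hb
    refine htwin a b ?_
    ext c
    simp only [SimpleGraph.mem_neighborSet]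
    constructor
    · intro hac
      rw [ha.2.2.2 c (hs a p ha c hac) hac]
      exact hb.2.2.1
    · intro hbc
      rw [hb.2.2.2 c (hs b p hb c hbc) hbc]
      exact ha.2.2.1
  -- Isolated vertices are twins of one another, so erasing one leaves none. If there is none to
  -- begin with, the stronger bound at `n` holds and monotonicity finishes.
  by_cases hz : ∃ z, ∀ b, ¬ F.Adj z b
  · obtain ⟨z, hz⟩ := hz
    have hgood : F.LeafTwinFreeOn (Finset.univ.erase z) := by
      constructor
      · intro a ha
        by_contra! hcon
        refine Finset.ne_of_mem_erase ha (htwin a z ?_)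
        ext b
        simp only [SimpleGraph.mem_neighborSet, hz b, iff_false]
        intro hab
        refine hcon b (Finset.mem_erase.2 ⟨?_, Finset.mem_univ b⟩) hab
        rintro rfl
        exact hz a hab.symm
      · refine pend _ fun a p _ c hac => Finset.mem_erase.2 ⟨?_, Finset.mem_univ c⟩
        rintro rfl
        exact hz a hac.symm
    have h := hgood.minTreeBound_le hforest
    rw [Finset.card_erase_of_mem (Finset.mem_univ z), Finset.card_univ, hcard] at h
    rwa [SimpleGraph.misCard_erase_of_isolated (Finset.mem_univ z) fun b _ => hz b]
  · push Not at hz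
    have hgood : F.LeafTwinFreeOn Finset.univ :=
      ⟨fun a _ => (hz a).imp fun b hb => ⟨Finset.mem_univ b, hb⟩,
        pend _ fun _ _ _ c _ => Finset.mem_univ c⟩
    have h := hgood.minTreeBound_le hforest
    rw [Finset.card_univ, hcard] at h
    have h2 := minTreeBound_le_succ (n - 1)
    rw [Nat.sub_add_cancel (by omega)] at h2
    exact h2.trans h
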